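/- Let $m$ be a positive integer all of whose prime factors are at least $5$, let $\zeta_m$ be a primitive complex $m$-th root of unity, and let $C_m$ be a (multiplicative) cyclic group of order $m$ with generator $g$. Put $G=\mathbb{Z}_3^3$ (written additively) and let $f: G\to\mathbb{Z}_m$ be a generalized bent function (GBF), i.e. $$\Bigl|\sum_{x\in G}\zeta_m^{f(x)}\chi(x)\Bigr|^2=|G|=27\qquad\text{for every character }\chi: G\to\mathbb{C}^*.$$ For $x\in G$ let $$E_x=\sum_{y\in G} g^{f(x+y)-f(y)}\in\mathbb{Z}[C_m]$$ be the autocorrelation element of $f$ at $x$, and for a divisor $t$ of $m$ let $D_t=\sum_{d}d\in\mathbb{Z}[C_m]$, the sum over the elements $d$ of the unique subgroup of $C_m$ of order $t$. Then for each $x\in G$ with $x\neq 0$ there are integers $\alpha_x,\beta_x,\gamma_x,\delta_x,\omega_x$ such that at least one of the following holds (where in each case the orders of the subgroups that occur divide $m$): 1. $5\mid m$, $7\mid m$ and $E_x=D_5\bigl(g^{\alpha_x}+g^{\beta_x}+g^{\gamma_x}+g^{\delta_x}\bigr)+D_7\,g^{\omega_x}$; 2. $5\mid m$, $11\mid m$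 and $E_x=D_5\,g^{\alpha_x}+D_{11}\bigl(g^{\beta_x}+g^{\gamma_x}\bigr)$; 3. $5\mid m$, $17\mid m$ and $E_x=D_5\bigl(g^{\alpha_x}+g^{\beta_x}\bigr)+D_{17}\,g^{\gamma_x}$; 4. $7\mid m$, $13\mid m$ and $E_x=D_7\bigl(g^{\alpha_x}+g^{\beta_x}\bigr)+D_{13}\,g^{\gamma_x}$. -/

import Mathlib

namespace GBF

/-- `f : G → ℤ/m` is a generalized bent function with respect to the `m`-th root of unity `ζ`:
`|∑ₓ ζ^{f(x)} χ(x)|² = |G|` for every complex character `χ` of the finite abelian group `G`. -/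
def IsGBF {G : Type*} [AddCommGroup G] [Fintype G] {m : ℕ} (ζ : ℂ) (f : G → ZMod m) : Prop :=
  ∀ χ : AddChar G ℂ, ‖∑ x : G, ζ ^ (f x).val * χ x‖ ^ 2 = (Fintype.card G : ℝ)

/-- A group element, seen as a basis element of the integral group ring `ℤ[C]`. -/
noncomputable def elt {C : Type*} [CommGroup C] (c : C) : MonoidAlgebra ℤ C :=
  MonoidAlgebra.of ℤ C c

/-- The autocorrelation element `E_x = ∑_y g^{f(x+y) - f(y)}` in `ℤ[C]`, where `g` generates the
cyclic group `C` of order `m`. -/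
noncomputable def autocorr {G : Type*} [AddCommGroup G] [Fintype G] {m : ℕ}
    {C : Type*} [CommGroup C] (g : C) (f : G → ZMod m) (x : G) : MonoidAlgebra ℤ C :=
  ∑ y : G, elt (g ^ (f (x + y) - f y).val)

open Classical in
/-- The element `D_t` of `ℤ[C]`: for `C` cyclic and `t` a divisor of its order, the sum of the
elements of the unique subgroup of order `t`, which consists of the `d` with `d ^ t = 1`
(see `D_eq_sum_subgroup`). -/
noncomputable def D (C : Type*) [CommGroup C] [Fintype C] (t : ℕ) : MonoidAlgebra ℤ C :=
  ∑ d : C with d ^ t = 1, elt d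

open Classical in
/-- In a cyclic group, `D_t` is the sum of the elements of any subgroup of order `t`. -/
theorem D_eq_sum_subgroup {C : Type*} [CommGroup C] [Fintype C] [IsCyclic C] (t : ℕ)
    (H : Subgroup C) (hH : Nat.card H = t) : D C t = ∑ d : C with d ∈ H, elt d := by
  have ht : 0 < t := hH ▸ Nat.card_pos
  have hsub : (Finset.univ.filter fun d : C => d ∈ H) ⊆
      Finset.univ.filter fun d : C => d ^ t = 1 := by
    intro d hd
    simp only [Finset.mem_filter, Finset.mem_univ, true_and] at hd ⊢
    have h : (⟨d, hd⟩ : H) ^ Nat.card H = 1 := pow_card_eq_one'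
    rw [hH] at h
    simpa using congrArg Subtype.val h
  have hcard : (Finset.univ.filter fun d : C => d ∈ H).card = t := by
    rw [← hH, Nat.card_eq_fintype_card, Fintype.card_subtype]
  have heq := Finset.eq_of_subset_of_card_le hsub
    (by rw [hcard]; exact IsCyclic.card_pow_eq_one_le ht)
  rw [D, heq]

end GBF

/-! Fourier inversion turns bentness into `∑_y ζ^(f(x+y)-f(y)) = 0` for `x ≠ 0`, so an injective
character of `C` kills `E_x`, a sum of 27 group elements. By `exists_coset_of_value_eq_zero`, such a
short sum contains a full coset of a subgroup of prime order `r ≥ 5`. That coset itself sums to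
zero, so cosets can be peeled off until nothing is left. The four cases are the ways to write 27 as
a sum of primes at least 5: `4·5+7`, `5+2·11`, `2·5+17`, `2·7+13`.

The core is `eqOn_mu_of_value_eq`. It compares two coset-free sums `x`, `y`, since comparison with
zero alone would not carry an induction. Let `n = q * k` with `q` the largest prime factor, and
split both sums into `q` pieces along the cosets of `mu k`. If `q ∣ k`, corresponding pieces have
equal values. Otherwise their values differ by a constant independent of the piece; for `k > 1`, a
light piece `y_i` with `x_i` empty is moved across, so that `x_j + y_i` and `y_j` have equal values
and induction applies. -/

/-! ### Linear independence over cyclotomic fields -/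

open Polynomial IntermediateField in
/-- If a primitive `n`-th root of unity lies in `ℚ(z, ξ)` with `z` a primitive `k`-th root of unity
and `φ n = φ k * d`, then `ξ` satisfies no nontrivial polynomial of degree `< d` over `ℚ(z)`. -/
theorem coeff_eq_zero_of_sum_pow_mul_eq_zero {n k d : ℕ} (hn : 0 < n) (hk : 0 < k) {z w ξ : ℂ}
    (hz : IsPrimitiveRoot z k) (hw : IsPrimitiveRoot w n) (hξ : IsIntegral ℚ⟮z⟯ ξ)
    (hmem : w ∈ ℚ⟮z⟯⟮ξ⟯) (hd : n.totient = k.totient * d) (X : ℕ → ℂ) (hX : ∀ j, X j ∈ ℚ⟮z⟯)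
    (h : ∑ j ∈ Finset.range d, ξ ^ j * X j = 0) : ∀ j < d, X j = 0 := by
  have fink : Module.finrank ℚ ℚ⟮z⟯ = k.totient := by
    rw [adjoin.finrank (hz.isIntegral hk).tower_top, ← cyclotomic_eq_minpoly_rat hz hk,
      natDegree_cyclotomic]
  have finn : Module.finrank ℚ ℚ⟮w⟯ = n.totient := by
    rw [adjoin.finrank (hw.isIntegral hn).tower_top, ← cyclotomic_eq_minpoly_rat hw hn,
      natDegree_cyclotomic]
  have : FiniteDimensional ℚ ℚ⟮z⟯ := adjoin.finiteDimensional (hz.isIntegral hk).tower_top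
  have : FiniteDimensional ℚ⟮z⟯ ℚ⟮z⟯⟮ξ⟯ := adjoin.finiteDimensional hξ
  have : FiniteDimensional ℚ ℚ⟮z⟯⟮ξ⟯ := FiniteDimensional.trans ℚ ℚ⟮z⟯ ℚ⟮z⟯⟮ξ⟯
  -- `ℚ(w)`, of degree `φ n = φ k * d`, embeds in `ℚ(z, ξ)`, so `ξ` has degree at least `d` over
  -- `ℚ(z)`.
  have hle : ℚ⟮w⟯ ≤ ℚ⟮z⟯⟮ξ⟯.restrictScalars ℚ := by
    rw [adjoin_simple_le_iff]
    exact hmem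
  have hfr : Module.finrank ℚ ℚ⟮w⟯ ≤ Module.finrank ℚ ℚ⟮z⟯⟮ξ⟯ :=
    LinearMap.finrank_le_finrank_of_injective
      (f := (IntermediateField.inclusion hle).toLinearMap) (IntermediateField.inclusion hle).injective
  rw [finn, ← Module.finrank_mul_finrank ℚ ℚ⟮z⟯ ℚ⟮z⟯⟮ξ⟯, fink, hd, adjoin.finrank hξ] at hfr
  have hdeg := Nat.le_of_mul_le_mul_left hfr (Nat.totient_pos.2 hk)
  let P : (ℚ⟮z⟯)[X] := ∑ j ∈ Finset.range d, C ⟨X j, hX j⟩ * Polynomial.X ^ j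
  have hP : aeval ξ P = 0 := by
    simp only [P, map_sum, map_mul, aeval_C, map_pow, aeval_X]
    rw [← h]
    exact Finset.sum_congr rfl fun j _ => mul_comm _ _
  have hP0 : P = 0 := by
    by_contra hne
    have h1 := natDegree_le_of_dvd (minpoly.dvd _ _ hP) hne
    rcases Nat.eq_zero_or_pos d with rfl | hd0
    · simp [P] at hne
    have h2 : P.natDegree ≤ d - 1 := natDegree_sum_le_of_forall_le _ _ fun j hj =>
      (natDegree_C_mul_X_pow_le _ _).trans (by have := Finset.mem_range.1 hj; omega)
    omega
  intro j hj
  have := congrArg (fun p => coeff p j) hP0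
  simp only [P, finsetSum_coeff, coeff_C_mul_X_pow, coeff_zero, Finset.sum_ite_eq,
    Finset.mem_range, hj, if_true] at this
  exact congrArg Subtype.val this

/-! ### Multisets of roots of unity -/

/-- The `n`-th complex roots of unity. -/
noncomputable abbrev mu (n : ℕ) : Finset ℂ := Polynomial.nthRootsFinset n (1 : ℂ)

theorem mem_mu {n : ℕ} (hn : 0 < n) {z : ℂ} : z ∈ mu n ↔ z ^ n = 1 :=
  Polynomial.mem_nthRootsFinset hn 1

/-- The total weight of a multiplicity function on the `n`-th roots of unity. -/
noncomputable def weight (n : ℕ) (x : ℂ → ℕ) : ℕ := ∑ η ∈ mu n, x η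

/-- The sum of the `n`-th roots of unity, counted with multiplicity. -/
noncomputable def value (n : ℕ) (x : ℂ → ℕ) : ℂ := ∑ η ∈ mu n, (x η : ℂ) * η

/-- No coset of a subgroup of prime order lies in the support. -/
def CosetFree (n : ℕ) (x : ℂ → ℕ) : Prop :=
  ∀ r, r.Prime → r ∣ n → ∀ η ∈ mu n, ∃ θ ∈ mu r, x (θ * η) = 0

/-- The multiplicity function rotated by `a`. -/
def rotate (a : ℂ) (x : ℂ → ℕ) : ℂ → ℕ := fun η => x (a * η)

theorem value_mem {k : ℕ} (hk : 0 < k) {z : ℂ} (hz : IsPrimitiveRoot z k) (x : ℂ → ℕ) :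
    value k x ∈ IntermediateField.adjoin ℚ {z} := by
  have : NeZero k := ⟨hk.ne'⟩
  refine sum_mem fun η hη => mul_mem (natCast_mem _ _) ?_
  obtain ⟨i, -, rfl⟩ := hz.eq_pow_of_pow_eq_one ((mem_mu hk).1 hη)
  exact pow_mem (IntermediateField.mem_adjoin_simple_self ℚ z) i

theorem value_add (k : ℕ) (x y : ℂ → ℕ) : value k (x + y) = value k x + value k y := by
  simp [value, add_mul, Finset.sum_add_distrib]

theorem weight_add (k : ℕ) (x y : ℂ → ℕ) : weight k (x + y) = weight k x + weight k y := by
  simp [weight, Finset.sum_add_distrib]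

theorem weight_eq_zero {k : ℕ} {x : ℂ → ℕ} : weight k x = 0 ↔ ∀ η ∈ mu k, x η = 0 := by
  simp [weight]

theorem value_eq_zero_of_weight {k : ℕ} {x : ℂ → ℕ} (h : weight k x = 0) : value k x = 0 :=
  Finset.sum_eq_zero fun η hη => by simp [weight_eq_zero.1 h η hη]

/-! ### Splitting along the cosets of `mu k` in `mu (q * k)` -/

section decomposition

variable {q k : ℕ} {ξ : ℂ}

/-- Requiring only `ξ ^ k` to be a primitive `q`-th root covers both later choices: `ξ` of order `q
* k` when `q ∣ k`, and of order `q` when `q ∤ k`. -/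
theorem pow_mul_mem_mu (hq : 0 < q) (hk : 0 < k) (hξ : IsPrimitiveRoot (ξ ^ k) q) (j : ℕ) {η : ℂ}
    (hη : η ∈ mu k) : ξ ^ j * η ∈ mu (q * k) := by
  rw [mem_mu hk] at hη
  rw [mem_mu (Nat.mul_pos hq hk), mul_pow, mul_comm q k, pow_mul η, hη, one_pow, mul_one,
    ← pow_mul, mul_comm j, pow_mul, pow_mul, hξ.pow_eq_one, one_pow]

/-- Taking `k`-th powers kills the factor in `mu k` and so recovers the exponent of `ξ`. -/
theorem injOn_pow_mul (hk : 0 < k) (hξ : IsPrimitiveRoot (ξ ^ k) q) (hξ0 : ξ ≠ 0) :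
    Set.InjOn (fun p : ℕ × ℂ => ξ ^ p.1 * p.2) (Finset.range q ×ˢ mu k : Finset (ℕ × ℂ)) := by
  rintro ⟨i, a⟩ hia ⟨j, b⟩ hjb h
  simp only [Finset.coe_product, Set.mem_prod, Finset.mem_coe, Finset.mem_range, mem_mu hk]
    at hia hjb h
  have h1 := congrArg (· ^ k) h
  simp only [mul_pow, hia.2, hjb.2, mul_one, ← pow_mul] at h1
  rw [mul_comm i, mul_comm j, pow_mul, pow_mul] at h1
  have := hξ.pow_inj hia.1 hjb.1 h1
  subst this
  simpa [hξ0] using h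

theorem image_pow_mul (hq : 0 < q) (hk : 0 < k) (hξ : IsPrimitiveRoot (ξ ^ k) q) (hξ0 : ξ ≠ 0) :
    (Finset.range q ×ˢ mu k).image (fun p : ℕ × ℂ => ξ ^ p.1 * p.2) = mu (q * k) := by
  apply Finset.eq_of_subset_of_card_le
  · intro z hz
    obtain ⟨p, hp, rfl⟩ := Finset.mem_image.1 hz
    exact pow_mul_mem_mu hq hk hξ _ (Finset.mem_product.1 hp).2
  · rw [Finset.card_image_of_injOn (injOn_pow_mul hk hξ hξ0), Finset.card_product,
      Finset.card_range, (Complex.isPrimitiveRoot_exp k hk.ne').card_nthRootsFinset,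
      (Complex.isPrimitiveRoot_exp (q * k) (Nat.mul_pos hq hk).ne').card_nthRootsFinset]

theorem sum_mu_mul {M : Type*} [AddCommMonoid M] (hq : 0 < q) (hk : 0 < k)
    (hξ : IsPrimitiveRoot (ξ ^ k) q) (hξ0 : ξ ≠ 0) (F : ℂ → M) :
    ∑ η ∈ mu (q * k), F η = ∑ j ∈ Finset.range q, ∑ η ∈ mu k, F (ξ ^ j * η) := by
  rw [← image_pow_mul hq hk hξ hξ0, Finset.sum_image (injOn_pow_mul hk hξ hξ0),
    Finset.sum_product]

theorem exists_pow_mul (hq : 0 < q) (hk : 0 < k) (hξ : IsPrimitiveRoot (ξ ^ k) q) (hξ0 : ξ ≠ 0)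
    {z : ℂ} (hz : z ∈ mu (q * k)) : ∃ j < q, ∃ η ∈ mu k, ξ ^ j * η = z := by
  rw [← image_pow_mul hq hk hξ hξ0] at hz
  simpa [and_assoc] using hz

theorem weight_mul (hq : 0 < q) (hk : 0 < k) (hξ : IsPrimitiveRoot (ξ ^ k) q) (hξ0 : ξ ≠ 0)
    (x : ℂ → ℕ) :
    weight (q * k) x = ∑ j ∈ Finset.range q, weight k (rotate (ξ ^ j) x) :=
  sum_mu_mul hq hk hξ hξ0 _

theorem value_mul (hq : 0 < q) (hk : 0 < k) (hξ : IsPrimitiveRoot (ξ ^ k) q) (hξ0 : ξ ≠ 0)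
    (x : ℂ → ℕ) :
    value (q * k) x = ∑ j ∈ Finset.range q, ξ ^ j * value k (rotate (ξ ^ j) x) := by
  rw [value, sum_mu_mul hq hk hξ hξ0]
  refine Finset.sum_congr rfl fun j _ => ?_
  rw [value, Finset.mul_sum]
  exact Finset.sum_congr rfl fun η _ => by rw [rotate]; ring

theorem CosetFree.rotate (hq : 0 < q) (hk : 0 < k) (hξ : IsPrimitiveRoot (ξ ^ k) q) {x : ℂ → ℕ}
    (hx : CosetFree (q * k) x) (j : ℕ) : CosetFree k (rotate (ξ ^ j) x) := by
  intro r hr hrk η hη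
  obtain ⟨θ, hθ, h⟩ := hx r hr (hrk.mul_left q) _ (pow_mul_mem_mu hq hk hξ j hη)
  exact ⟨θ, hθ, by rw [_root_.rotate, ← h]; ring_nf⟩

end decomposition

/-! ### Coset-free sums and their uniqueness -/

/-- A multiplicity function of weight below every prime factor of `k` is coset free. -/
theorem cosetFree_of_weight_lt {k b : ℕ} (hk : 0 < k) (hp : ∀ p : ℕ, p.Prime → p ∣ k → b ≤ p)
    {x : ℂ → ℕ} (hx : weight k x < b) : CosetFree k x := by
  intro r hr hrk η hη
  by_contra! hne
  have hη0 : η ≠ 0 := by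
    rintro rfl
    simp [mem_mu hk, hk.ne'] at hη
  have hsub : (mu r).image (· * η) ⊆ mu k := by
    intro z hz
    obtain ⟨θ, hθ, rfl⟩ := Finset.mem_image.1 hz
    rw [mem_mu hr.pos] at hθ
    rw [mem_mu hk] at hη ⊢
    obtain ⟨c, rfl⟩ := hrk
    rw [mul_pow, hη, pow_mul, hθ, one_pow, mul_one]
  have h1 : ∑ θ ∈ mu r, x (θ * η) ≤ weight k x := by
    rw [← Finset.sum_image (f := x) (g := (· * η)) (fun a _ b _ h => mul_right_cancel₀ hη0 h)]
    exact Finset.sum_le_sum_of_subset hsub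
  have h2 : (mu r).card • 1 ≤ ∑ θ ∈ mu r, x (θ * η) :=
    Finset.card_nsmul_le_sum _ _ _ fun θ hθ => Nat.one_le_iff_ne_zero.2 (hne θ hθ)
  rw [(Complex.isPrimitiveRoot_exp r hr.ne_zero).card_nthRootsFinset] at h2
  have := hp r hr hrk
  simp at h2
  omega

/-- If `q ∣ k`, the powers `1, ξ, …, ξ ^ (q - 1)` of a primitive `q * k`-th root of unity are
independent over the field of `k`-th roots of unity. -/
theorem eq_zero_of_sum_pow_mul_eq_zero {q k : ℕ} (hq : q.Prime) (hk : 0 < k) (hqk : q ∣ k)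
    {z ξ : ℂ} (hz : IsPrimitiveRoot z k) (hξ : IsPrimitiveRoot ξ (q * k)) (X : ℕ → ℂ)
    (hX : ∀ j, X j ∈ IntermediateField.adjoin ℚ {z})
    (h : ∑ j ∈ Finset.range q, ξ ^ j * X j = 0) : ∀ j < q, X j = 0 := by
  have hn := Nat.mul_pos hq.pos hk
  refine coeff_eq_zero_of_sum_pow_mul_eq_zero hn hk hz hξ (hξ.isIntegral hn).tower_top
    (IntermediateField.mem_adjoin_simple_self _ ξ) ?_ X hX h
  rw [Nat.totient_mul_of_prime_of_dvd hq hqk, mul_comm]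

/-- If `q ∤ k`, the only relations between the `q`-th roots of unity over the field of `k`-th roots
of unity are the multiples of the relation that their sum is zero. -/
theorem eq_last_of_sum_pow_mul_eq_zero {q k : ℕ} (hq : q.Prime) (hk : 0 < k) (hqk : ¬ q ∣ k)
    {z ξ : ℂ} (hz : IsPrimitiveRoot z k) (hξ : IsPrimitiveRoot ξ q) (X : ℕ → ℂ)
    (hX : ∀ j, X j ∈ IntermediateField.adjoin ℚ {z})
    (h : ∑ j ∈ Finset.range q, ξ ^ j * X j = 0) : ∀ j < q, X j = X (q - 1) := by
  have hn := Nat.mul_pos hq.pos hk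
  have hco : (orderOf z).Coprime (orderOf ξ) := by
    rw [← hz.eq_orderOf, ← hξ.eq_orderOf]
    exact ((hq.coprime_iff_not_dvd).2 hqk).symm
  have hw : IsPrimitiveRoot (z * ξ) (q * k) := by
    have := (Commute.all z ξ).orderOf_mul_eq_mul_orderOf_of_coprime hco
    rw [← hz.eq_orderOf, ← hξ.eq_orderOf, mul_comm k] at this
    exact this ▸ IsPrimitiveRoot.orderOf (z * ξ)
  have key := coeff_eq_zero_of_sum_pow_mul_eq_zero (d := q - 1) hn hk hz hw
    (hξ.isIntegral hq.pos).tower_top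
    (mul_mem (IntermediateField.algebraMap_mem _
      (⟨z, IntermediateField.mem_adjoin_simple_self ℚ z⟩ : IntermediateField.adjoin ℚ {z}))
      (IntermediateField.mem_adjoin_simple_self _ ξ))
    (by rw [Nat.totient_mul_of_prime_of_not_dvd hq hqk, mul_comm])
    -- Subtracting `X (q - 1)` times the vanishing geometric sum removes the last term, leaving `q -
    -- 1 = φ q` powers.
    (fun j => X j - X (q - 1)) (fun j => sub_mem (hX j) (hX _)) (by
      have hgeom := hξ.geom_sum_eq_zero hq.one_lt
      obtain ⟨s, rfl⟩ : ∃ s, q = s + 1 := ⟨q - 1, by have := hq.pos; omega⟩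
      have h0 : ∑ j ∈ Finset.range (s + 1), ξ ^ j * (X j - X s) = 0 := by
        simp only [mul_sub, Finset.sum_sub_distrib, h, ← Finset.sum_mul, hgeom]
        ring
      simpa [Finset.sum_range_succ] using h0)
  intro j hj
  rcases Nat.lt_or_ge j (q - 1) with h1 | h1
  · exact sub_eq_zero.1 (key j h1)
  · rw [show j = q - 1 by omega]

/-- Coset-free multiplicity functions of small weight are determined by their value. -/
theorem eqOn_mu_of_value_eq (n : ℕ) : 0 < n → (∀ p : ℕ, p.Prime → p ∣ n → 5 ≤ p) →
    ∀ x y : ℂ → ℕ, CosetFree n x → CosetFree n y → 6 * weight n x + weight n y < 30 →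
      value n x = value n y → ∀ η ∈ mu n, x η = y η := by
  induction n using Nat.strong_induction_on with
  | _ n ih =>
  intro hn hp x y hx hy hw hv
  rcases eq_or_ne n 1 with rfl | hn1
  · intro η hη
    have : ∀ u : ℂ → ℕ, value 1 u = u 1 := by
      intro u
      have : mu 1 = {1} := by ext z; simp
      simp [value, this]
    rw [this, this] at hv
    rw [mem_mu one_pos, pow_one] at hη
    subst hη
    exact_mod_cast hv
  have hne : n.primeFactors.Nonempty := Nat.nonempty_primeFactors.2 (by omega)
  obtain ⟨q, hqmem, hqmax⟩ := n.primeFactors.exists_max_image id hne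
  have hq := Nat.prime_of_mem_primeFactors hqmem
  obtain ⟨k, rfl⟩ := Nat.dvd_of_mem_primeFactors hqmem
  have hk : 0 < k := Nat.pos_of_mul_pos_left hn
  have hkn : k < q * k := by nlinarith [hq.two_le]
  have hpk : ∀ p : ℕ, p.Prime → p ∣ k → 5 ≤ p := fun p h1 h2 => hp p h1 (h2.mul_left q)
  have hz := Complex.isPrimitiveRoot_exp k hk.ne'
  by_cases hqk : q ∣ k
  · obtain ⟨ξ, hξ⟩ : ∃ ξ : ℂ, IsPrimitiveRoot ξ (q * k) := ⟨_, Complex.isPrimitiveRoot_exp _ hn.ne'⟩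
    have hξ0 : ξ ≠ 0 := hξ.ne_zero hn.ne'
    have hξk : IsPrimitiveRoot (ξ ^ k) q := hξ.pow hn (mul_comm q k)
    rw [value_mul hq.pos hk hξk hξ0, value_mul hq.pos hk hξk hξ0, ← sub_eq_zero,
      ← Finset.sum_sub_distrib] at hv
    simp only [← mul_sub] at hv
    have hval := eq_zero_of_sum_pow_mul_eq_zero hq hk hqk hz hξ _
      (fun j => sub_mem (value_mem hk hz _) (value_mem hk hz _)) hv
    rw [weight_mul hq.pos hk hξk hξ0, weight_mul hq.pos hk hξk hξ0] at hw
    intro η hη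
    obtain ⟨j, hj, η, hη', rfl⟩ := exists_pow_mul hq.pos hk hξk hξ0 hη
    have h1 := Finset.single_le_sum (f := fun j => weight k (rotate (ξ ^ j) x))
      (fun _ _ => Nat.zero_le _) (Finset.mem_range.2 hj)
    have h2 := Finset.single_le_sum (f := fun j => weight k (rotate (ξ ^ j) y))
      (fun _ _ => Nat.zero_le _) (Finset.mem_range.2 hj)
    exact ih k hkn hk hpk _ _ (hx.rotate hq.pos hk hξk j) (hy.rotate hq.pos hk hξk j)
      (by omega) (sub_eq_zero.1 (hval j hj)) η hη'
  obtain ⟨ξ, hξ⟩ : ∃ ξ : ℂ, IsPrimitiveRoot ξ q := ⟨_, Complex.isPrimitiveRoot_exp _ hq.ne_zero⟩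
  have hξ0 : ξ ≠ 0 := hξ.ne_zero hq.ne_zero
  have hξk : IsPrimitiveRoot (ξ ^ k) q :=
    hξ.pow_of_coprime k ((hq.coprime_iff_not_dvd).2 hqk).symm
  rw [value_mul hq.pos hk hξk hξ0, value_mul hq.pos hk hξk hξ0, ← sub_eq_zero,
    ← Finset.sum_sub_distrib] at hv
  simp only [← mul_sub] at hv
  have hval := eq_last_of_sum_pow_mul_eq_zero hq hk hqk hz hξ _
    (fun j => sub_mem (value_mem hk hz _) (value_mem hk hz _)) hv
  have hcoset : ∀ u : ℂ → ℕ, CosetFree (q * k) u → ∀ η ∈ mu k, ∃ j < q, u (ξ ^ j * η) = 0 := by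
    intro u hu η hη
    have hη' : η ∈ mu (q * k) := by simpa using pow_mul_mem_mu hq.pos hk hξk 0 hη
    obtain ⟨θ, hθ, h⟩ := hu q hq (dvd_mul_right q k) η hη'
    have : NeZero q := ⟨hq.ne_zero⟩
    obtain ⟨j, hj, rfl⟩ := hξ.eq_pow_of_pow_eq_one ((mem_mu hq.pos).1 hθ)
    exact ⟨j, hj, h⟩
  rcases eq_or_ne k 1 with rfl | hk1
  · have hv1 : ∀ (u : ℂ → ℕ) (j : ℕ), value 1 (rotate (ξ ^ j) u) = u (ξ ^ j) := by
      intro u j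
      have : mu 1 = {1} := by ext z; simp
      simp [value, this, rotate]
    obtain ⟨i, hi, hxi⟩ := hcoset x hx 1 (by simp)
    obtain ⟨j, hj, hyj⟩ := hcoset y hy 1 (by simp)
    rw [mul_one] at hxi hyj
    -- For `k = 1` the pieces are natural numbers with `x - y` constant. As `x` and `y` both vanish
    -- somewhere, that constant is zero.
    have hval' : ∀ a < q, ∀ b < q, x (ξ ^ a) + y (ξ ^ b) = x (ξ ^ b) + y (ξ ^ a) := by
      intro a ha b hb
      have := (hval a ha).trans (hval b hb).symm
      simp only [hv1] at this
      have h : ((x (ξ ^ a) + y (ξ ^ b) : ℕ) : ℂ) = ((x (ξ ^ b) + y (ξ ^ a) : ℕ) : ℂ) := by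
        push_cast
        linear_combination this
      exact_mod_cast h
    intro η hη
    obtain ⟨a, ha, b, hb, rfl⟩ := exists_pow_mul hq.pos hk hξk hξ0 hη
    rw [mem_mu one_pos, pow_one] at hb
    subst hb
    rw [mul_one]
    have := hval' i hi j hj
    have := hval' a ha i hi
    omega
  -- `k` has a prime factor at least 5, and it is smaller than the maximal `q`.
  have hq7 : 7 ≤ q := by
    obtain ⟨p, hp1, hpk1⟩ := Nat.exists_prime_and_dvd hk1
    have h5 := hpk p hp1 hpk1
    have hpq : p ≤ q := hqmax p (Nat.mem_primeFactors.2 ⟨hp1, hpk1.mul_left q, hn.ne'⟩)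
    have hne : p ≠ q := fun h => hqk (h ▸ hpk1)
    have h6 : q ≠ 6 := by rintro rfl; revert hq; decide
    omega
  rw [weight_mul hq.pos hk hξk hξ0, weight_mul hq.pos hk hξk hξ0, Finset.mul_sum,
    ← Finset.sum_add_distrib] at hw
  set a : ℕ → ℕ := fun j => weight k (rotate (ξ ^ j) x) with ha
  set b : ℕ → ℕ := fun j => weight k (rotate (ξ ^ j) y) with hb
  change ∑ j ∈ Finset.range q, (6 * a j + b j) < 30 at hw
  -- If no piece of `x` were empty, the total cost would be at least `6 * q ≥ 42`.
  have hK : ((Finset.range q).filter fun j => a j = 0).Nonempty := by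
    by_contra hemp
    rw [Finset.not_nonempty_iff_eq_empty, Finset.filter_eq_empty_iff] at hemp
    have := Finset.card_nsmul_le_sum (Finset.range q) (fun j => 6 * a j + b j) 6
      fun j hj => by have := hemp hj; omega
    simp at this
    omega
  obtain ⟨i, hiK, hmin⟩ := Finset.exists_min_image _ b hK
  simp only [Finset.mem_filter, Finset.mem_range, and_imp] at hiK hmin
  obtain ⟨hi, hai⟩ := hiK
  have hbi : b i < 6 := by
    by_contra hge
    have := Finset.card_nsmul_le_sum (Finset.range q) (fun j => 6 * a j + b j) 6 fun j hj => by
      have := hmin j (Finset.mem_range.1 hj)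
      by_cases h0 : a j = 0 <;> omega
    simp at this
    omega
  -- Every piece costs at least `b i`: either `a l = 0` and `b i` is minimal, or the cost is at
  -- least `6 > b i`. There are `q - 1 ≥ 6` pieces besides `j`.
  have hcost : ∀ j < q, 6 * a j + b j + 6 * b i < 30 := by
    intro j hj
    have h1 := Finset.card_nsmul_le_sum ((Finset.range q).erase j) (fun j => 6 * a j + b j) (b i)
      fun l hl => by
        have := hmin l (Finset.mem_range.1 (Finset.mem_of_mem_erase hl))
        by_cases h0 : a l = 0 <;> omega
    have h2 := Finset.add_sum_erase (Finset.range q) (fun j => 6 * a j + b j)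
      (Finset.mem_range.2 hj)
    rw [Finset.card_erase_of_mem (Finset.mem_range.2 hj), Finset.card_range, smul_eq_mul] at h1
    have h3 : 6 * b i ≤ (q - 1) * b i := Nat.mul_le_mul_right _ (by omega)
    omega
  -- The bound `hcost` is exactly the inductive weight hypothesis for `x_j + y_i` against `y_j`. It
  -- also gives `a j + b i < 5`, too light to contain a coset.
  have heq : ∀ j < q, ∀ η ∈ mu k, (rotate (ξ ^ j) x + rotate (ξ ^ i) y) η = rotate (ξ ^ j) y η := by
    intro j hj
    have hc := hcost j hj
    apply ih k hkn hk hpk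
    · apply cosetFree_of_weight_lt hk hpk
      rw [weight_add]
      change a j + b i < 5
      omega
    · exact hy.rotate hq.pos hk hξk j
    · rw [weight_add]
      change 6 * (a j + b i) + b j < 30
      omega
    · have h1 := (hval j hj).trans (hval i hi).symm
      have h2 := value_eq_zero_of_weight hai
      rw [h2] at h1
      rw [value_add]
      linear_combination h1
  -- Each `η` has some `y_j` vanishing there, and `y_j = x_j + y_i` dominates `y_i`.
  have hzero : ∀ η ∈ mu k, rotate (ξ ^ i) y η = 0 := by
    intro η hη
    obtain ⟨j, hj, h⟩ := hcoset y hy η hη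
    have := heq j hj η hη
    rw [Pi.add_apply] at this
    change _ = y (ξ ^ j * η) at this
    omega
  intro η hη
  obtain ⟨j, hj, η, hη', rfl⟩ := exists_pow_mul hq.pos hk hξk hξ0 hη
  have := heq j hj η hη'
  rw [Pi.add_apply, hzero η hη', add_zero] at this
  exact this

/-- A nonempty vanishing sum of fewer than `30` roots of unity, of order without prime factors below
`5`, contains a coset of a subgroup of prime order. -/
theorem exists_coset_of_value_eq_zero {n : ℕ} (hn : 0 < n)
    (hp : ∀ p : ℕ, p.Prime → p ∣ n → 5 ≤ p) {y : ℂ → ℕ} (hw : weight n y < 30)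
    (hw0 : weight n y ≠ 0) (hv : value n y = 0) :
    ∃ r, r.Prime ∧ r ∣ n ∧ ∃ η ∈ mu n, ∀ θ ∈ mu r, y (θ * η) ≠ 0 := by
  by_contra! hfree
  have h0 : weight n 0 = 0 := weight_eq_zero.2 fun _ _ => rfl
  refine hw0 (weight_eq_zero.2 fun η hη => (eqOn_mu_of_value_eq n hn hp 0 y
    (fun r hr _ _ _ => ⟨1, by simp [mem_mu hr.pos], rfl⟩) hfree (by omega)
    ((value_eq_zero_of_weight h0).trans hv.symm) η hη).symm)

theorem sum_mu_eq_zero {r : ℕ} (hr : r.Prime) : ∑ θ ∈ mu r, θ = 0 := by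
  obtain ⟨ξ, hξ⟩ : ∃ ξ : ℂ, IsPrimitiveRoot ξ r := ⟨_, Complex.isPrimitiveRoot_exp _ hr.ne_zero⟩
  have h := sum_mu_mul hr.pos one_pos (by simpa using hξ) (hξ.ne_zero hr.ne_zero) (fun θ => θ)
  have h1 : mu 1 = {1} := by ext z; simp
  rw [mul_one] at h
  rw [h, ← hξ.geom_sum_eq_zero hr.one_lt]
  simp [h1]

/-! ### Transfer to the group ring and peeling of cosets -/

section group

variable {C : Type*} [CommGroup C] [Fintype C] {χ : C →* ℂ}

theorem image_univ_eq_mu (hχ : Function.Injective χ) :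
    Finset.univ.image χ = mu (Fintype.card C) := by
  apply Finset.eq_of_subset_of_card_le
  · intro z hz
    obtain ⟨c, -, rfl⟩ := Finset.mem_image.1 hz
    rw [mem_mu Fintype.card_pos, ← map_pow, pow_card_eq_one, map_one]
  · rw [Finset.card_image_of_injective _ hχ, Finset.card_univ,
      (Complex.isPrimitiveRoot_exp _ Fintype.card_ne_zero).card_nthRootsFinset]

theorem mu_subset_mu {r n : ℕ} (hr : 0 < r) (hn : 0 < n) (h : r ∣ n) : mu r ⊆ mu n := by
  intro θ hθ
  rw [mem_mu hr] at hθ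
  obtain ⟨c, rfl⟩ := h
  rw [mem_mu hn, pow_mul, hθ, one_pow]

open Classical in
theorem image_torsion_eq_mu (hχ : Function.Injective χ) {r : ℕ} (hr : 0 < r)
    (h : r ∣ Fintype.card C) : (Finset.univ.filter fun d : C => d ^ r = 1).image χ = mu r := by
  ext θ
  constructor
  · intro hθ
    obtain ⟨d, hd, rfl⟩ := Finset.mem_image.1 hθ
    rw [mem_mu hr, ← map_pow, (Finset.mem_filter.1 hd).2, map_one]
  · intro hθ
    have h1 := mu_subset_mu hr Fintype.card_pos h hθ
    rw [← image_univ_eq_mu hχ] at h1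
    obtain ⟨d, -, rfl⟩ := Finset.mem_image.1 h1
    rw [mem_mu hr, ← map_pow, ← map_one χ] at hθ
    exact Finset.mem_image.2 ⟨d, by simpa using hχ hθ, rfl⟩

theorem sum_mu_extend (hχ : Function.Injective χ) {M : Type*} [AddCommMonoid M] (u : C → ℕ)
    (F : ℕ → ℂ → M) :
    ∑ η ∈ mu (Fintype.card C), F (Function.extend χ u 0 η) η = ∑ c, F (u c) (χ c) := by
  rw [← image_univ_eq_mu hχ, Finset.sum_image hχ.injOn]
  exact Finset.sum_congr rfl fun c _ => by rw [hχ.extend_apply]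

theorem exists_coset_of_sum_eq_zero (hp : ∀ p : ℕ, p.Prime → p ∣ Fintype.card C → 5 ≤ p)
    (hχ : Function.Injective χ) (u : C → ℕ) (hu : ∑ c, u c < 30) (hu0 : ∑ c, u c ≠ 0)
    (hv : ∑ c, (u c : ℂ) * χ c = 0) :
    ∃ r, r.Prime ∧ r ∣ Fintype.card C ∧ ∃ c, ∀ d : C, d ^ r = 1 → u (d * c) ≠ 0 := by
  have hweight : weight (Fintype.card C) (Function.extend χ u 0) = ∑ c, u c :=
    sum_mu_extend hχ u fun i _ => i
  have hvalue : value (Fintype.card C) (Function.extend χ u 0) = ∑ c, (u c : ℂ) * χ c :=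
    sum_mu_extend hχ u fun i z => (i : ℂ) * z
  obtain ⟨r, hr, hrm, η, hη, h⟩ := exists_coset_of_value_eq_zero Fintype.card_pos hp
    (hweight ▸ hu) (hweight ▸ hu0) (hvalue.trans hv)
  rw [← image_univ_eq_mu hχ] at hη
  obtain ⟨c, -, rfl⟩ := Finset.mem_image.1 hη
  refine ⟨r, hr, hrm, c, fun d hd => ?_⟩
  have := h (χ d) (by rw [mem_mu hr.pos, ← map_pow, hd, map_one])
  rwa [← map_mul, hχ.extend_apply] at this

open Classical in
-- Stated for general `F` because removing a coset is tracked three times: in the weight, in the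
-- character value and in the group ring.
theorem sum_smul_eq_sum_sub_smul_add {M : Type*} [AddCommMonoid M] (u : C → ℕ) (T : Finset C)
    (c : C) (hu : ∀ d ∈ T, u (d * c) ≠ 0) (F : C → M) :
    ∑ e, u e • F e = ∑ e, (if e * c⁻¹ ∈ T then u e - 1 else u e) • F e + ∑ d ∈ T, F (d * c) := by
  have h1 : ∑ d ∈ T, F (d * c) = ∑ e, if e * c⁻¹ ∈ T then F e else 0 := by
    rw [← Equiv.sum_comp (Equiv.mulRight c)]
    simp
  rw [h1, ← Finset.sum_add_distrib]
  refine Finset.sum_congr rfl fun e _ => ?_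
  split_ifs with h
  · have := hu _ h
    rw [inv_mul_cancel_right] at this
    rw [← succ_nsmul, Nat.sub_add_cancel (Nat.one_le_iff_ne_zero.2 this)]
  · rw [add_zero]

open GBF in
theorem exists_subtract_coset (hp : ∀ p : ℕ, p.Prime → p ∣ Fintype.card C → 5 ≤ p)
    (hχ : Function.Injective χ) (u : C → ℕ) (hu : ∑ c, u c < 30) (hu0 : ∑ c, u c ≠ 0)
    (hv : ∑ c, (u c : ℂ) * χ c = 0) :
    ∃ r, r.Prime ∧ r ∣ Fintype.card C ∧ ∃ (c : C) (v : C → ℕ), ∑ c, u c = ∑ c, v c + r ∧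
      ∑ c, (v c : ℂ) * χ c = 0 ∧ ∑ c, u c • elt c = ∑ c, v c • elt c + D C r * elt c := by
  classical
  obtain ⟨r, hr, hrm, c, h⟩ := exists_coset_of_sum_eq_zero hp hχ u hu hu0 hv
  let T : Finset C := Finset.univ.filter fun d : C => d ^ r = 1
  have hT : ∀ d ∈ T, u (d * c) ≠ 0 := fun d hd => h d (Finset.mem_filter.1 hd).2
  have himg : T.image χ = mu r := image_torsion_eq_mu hχ hr.pos hrm
  refine ⟨r, hr, hrm, c, fun e => if e * c⁻¹ ∈ T then u e - 1 else u e, ?_, ?_, ?_⟩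
  · have h1 := sum_smul_eq_sum_sub_smul_add u T c hT fun _ => 1
    have h2 := congrArg Finset.card himg
    rw [Finset.card_image_of_injective _ hχ,
      (Complex.isPrimitiveRoot_exp r hr.ne_zero).card_nthRootsFinset] at h2
    simpa [h2] using h1
  · have h1 := sum_smul_eq_sum_sub_smul_add u T c hT fun e => χ e
    simp only [nsmul_eq_mul, map_mul] at h1
    rw [hv, ← Finset.sum_mul, ← Finset.sum_image (f := fun θ => θ) hχ.injOn, himg,
      sum_mu_eq_zero hr, zero_mul, add_zero] at h1
    exact h1.symm
  · rw [sum_smul_eq_sum_sub_smul_add u T c hT fun e => elt e, D, Finset.sum_mul]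
    simp [elt, T]

open GBF in
-- `A r` collects representatives of the peeled cosets of the subgroup of order `r`. Each peeling
-- lowers the weight by `r`, so the induction terminates, and `r ≤ N < 30`.
theorem exists_coset_decomposition (hp : ∀ p : ℕ, p.Prime → p ∣ Fintype.card C → 5 ≤ p)
    (hχ : Function.Injective χ) (N : ℕ) : N < 30 → ∀ u : C → ℕ, ∑ c, u c = N →
    ∑ c, (u c : ℂ) * χ c = 0 → ∃ A : ℕ → Multiset C,
      (∀ r, A r ≠ 0 → r.Prime ∧ r ∣ Fintype.card C) ∧
      ∑ r ∈ Finset.range 30, r * (A r).card = N ∧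
      ∑ c, u c • elt c = ∑ r ∈ Finset.range 30, D C r * ((A r).map elt).sum := by
  classical
  induction N using Nat.strong_induction_on with
  | _ N ih =>
  intro hN u hu hv
  rcases Nat.eq_zero_or_pos N with rfl | hpos
  · refine ⟨0, by simp, by simp, ?_⟩
    rw [Finset.sum_eq_zero_iff] at hu
    rw [Finset.sum_eq_zero fun c hc => by rw [hu c hc, zero_smul]]
    simp
  obtain ⟨r, hr, hrm, c, v, hw, hv', he⟩ :=
    exists_subtract_coset hp hχ u (hu ▸ hN) (hu ▸ hpos.ne') hv
  have hr30 : r ∈ Finset.range 30 := Finset.mem_range.2 (by omega)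
  obtain ⟨A, hA, hcard, hsum⟩ :=
    ih (∑ c, v c) (by have := hr.pos; omega) (by omega) v rfl hv'
  refine ⟨A + Pi.single r {c}, fun s hs => ?_, ?_, ?_⟩
  · by_cases h : s = r
    · exact h ▸ ⟨hr, hrm⟩
    · exact hA s (by simpa [h] using hs)
  · simp only [Pi.add_apply, Multiset.card_add, mul_add, Finset.sum_add_distrib, hcard]
    rw [Finset.sum_eq_single_of_mem r hr30 fun s _ hs => by simp [hs]]
    simp
    omega
  · simp only [Pi.add_apply, Multiset.map_add, Multiset.sum_add, mul_add, Finset.sum_add_distrib]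
    rw [Finset.sum_eq_single_of_mem (f := fun s =>
      D C s * (Multiset.map elt ((Pi.single r {c} : ℕ → Multiset C) s)).sum) r hr30
      fun s _ hs => by simp [hs], he, hsum]
    simp

end group

/-! ### Bent functions and the final case analysis -/

open scoped ComplexConjugate in
/-- The autocorrelation of a generalized bent function vanishes away from zero. -/
theorem GBF.IsGBF.sum_eq_zero {G : Type*} [AddCommGroup G] [Fintype G] {m : ℕ} [NeZero m] {ζ : ℂ}
    (hζ : ζ ^ m = 1) {f : G → ZMod m} (hf : GBF.IsGBF ζ f) {x : G} (hx : x ≠ 0) :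
    ∑ y, ζ ^ (f (x + y) - f y).val = 0 := by
  classical
  have hζ0 : ζ ≠ 0 := by
    rintro rfl
    simp [NeZero.ne m] at hζ
  have hconj : conj ζ = ζ⁻¹ :=
    (Complex.inv_eq_conj (Complex.norm_eq_one_of_pow_eq_one hζ (NeZero.ne m))).symm
  have hsub : ∀ a b : ZMod m, ζ ^ (a - b).val = ζ ^ a.val * (ζ ^ b.val)⁻¹ := by
    intro a b
    rw [eq_mul_inv_iff_mul_eq₀ (pow_ne_zero _ hζ0), ← pow_add, pow_eq_pow_mod _ hζ,
      ← ZMod.val_add, sub_add_cancel]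
  have hnorm : ∀ χ : AddChar G ℂ, ∑ a, ∑ b, ζ ^ (f a - f b).val * χ (a - b) = Fintype.card G := by
    intro χ
    have h := congrArg (fun t : ℝ => (t : ℂ)) (hf χ)
    simp only [Complex.ofReal_pow, Complex.ofReal_natCast] at h
    rw [← Complex.mul_conj', map_sum, Finset.sum_mul_sum] at h
    rw [← h]
    refine Finset.sum_congr rfl fun a _ => Finset.sum_congr rfl fun b _ => ?_
    rw [hsub, map_mul, map_pow, hconj, sub_eq_add_neg, AddChar.map_add_eq_mul,
      AddChar.map_neg_eq_conj, inv_pow]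
    ring
  -- Evaluate the inverse Fourier transform of the constant `|G|` at `x ≠ 0`; then `hswap`
  -- identifies it as `|G|` times the autocorrelation.
  have htotal : ∑ χ : AddChar G ℂ, χ (-x) * ∑ a, ∑ b, ζ ^ (f a - f b).val * χ (a - b) = 0 := by
    simp only [hnorm, ← Finset.sum_mul, AddChar.sum_apply_eq_ite, neg_eq_zero, hx, if_false,
      zero_mul]
  have hswap : ∑ χ : AddChar G ℂ, χ (-x) * ∑ a, ∑ b, ζ ^ (f a - f b).val * χ (a - b) =
      Fintype.card G * ∑ y, ζ ^ (f (x + y) - f y).val := by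
    simp only [Finset.mul_sum]
    rw [Finset.sum_comm]
    rw [Finset.sum_congr rfl fun a _ => Finset.sum_comm, Finset.sum_comm]
    refine Finset.sum_congr rfl fun b _ => ?_
    have : ∀ a, ∑ χ : AddChar G ℂ, χ (-x) * (ζ ^ (f a - f b).val * χ (a - b)) =
        ζ ^ (f a - f b).val * if a = x + b then (Fintype.card G : ℂ) else 0 := by
      intro a
      rw [show (a = x + b) = (-x + (a - b) = 0) by
        rw [neg_add_eq_zero, eq_sub_iff_add_eq, eq_comm (a := a)], ← AddChar.sum_apply_eq_ite,
        Finset.mul_sum]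
      exact Finset.sum_congr rfl fun χ _ => by rw [AddChar.map_add_eq_mul]; ring
    simp [this, mul_comm]
  rw [hswap, mul_eq_zero] at htotal
  exact htotal.resolve_left (Nat.cast_ne_zero.2 Fintype.card_ne_zero)

theorem exists_injective_hom {C : Type*} [CommGroup C] [Fintype C] {g : C}
    (hg : ∀ c : C, c ∈ Subgroup.zpowers g) {ζ : ℂ} (hζ : IsPrimitiveRoot ζ (Fintype.card C)) :
    ∃ χ : C →* ℂ, Function.Injective χ ∧ χ g = ζ := by
  have hord : orderOf g = Fintype.card C := by
    rw [orderOf_eq_card_of_forall_mem_zpowers hg, Nat.card_eq_fintype_card]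
  obtain ⟨w, rfl⟩ := hζ.isUnit Fintype.card_ne_zero
  have hw : IsPrimitiveRoot w (Fintype.card C) := IsPrimitiveRoot.coe_units_iff.1 hζ
  have hdvd : orderOf w ∣ orderOf g := by rw [hord, ← hw.eq_orderOf]
  refine ⟨(Units.coeHom ℂ).comp (monoidHomOfForallMemZpowers hg hdvd), ?_, ?_⟩
  · rw [MonoidHom.coe_comp]
    refine Function.Injective.comp Units.val_injective ((injective_iff_map_eq_one _).2 fun c hc => ?_)
    obtain ⟨i, rfl⟩ := hg c
    rw [map_zpow, monoidHomOfForallMemZpowers_apply_gen, hw.zpow_eq_one_iff_dvd, ← hord] at hc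
    exact orderOf_dvd_iff_zpow_eq_one.1 hc
  · simp [monoidHomOfForallMemZpowers_apply_gen]

theorem Multiset.exists_map_elt_sum {C : Type*} [CommGroup C] {g : C}
    (hg : ∀ c : C, c ∈ Subgroup.zpowers g) (s : Multiset C) :
    ∃ l : List ℤ, l.length = s.card ∧
      (s.map GBF.elt).sum = (l.map fun i => GBF.elt (g ^ i)).sum := by
  choose i hi using fun c => Subgroup.mem_zpowers_iff.1 (hg c)
  refine ⟨s.toList.map i, by simp, ?_⟩
  conv_lhs => rw [← s.coe_toList]
  simp [Function.comp_def, hi]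

open Classical in
theorem sum_card_fiber_smul {ι C M : Type*} [Fintype ι] [Fintype C] [AddCommMonoid M] (e : ι → C)
    (F : C → M) : ∑ c, (Finset.univ.filter fun y => e y = c).card • F c = ∑ y, F (e y) := by
  rw [← Finset.sum_fiberwise_of_maps_to (g := e) (t := Finset.univ) fun _ _ => Finset.mem_univ _]
  refine Finset.sum_congr rfl fun c _ => ?_
  rw [Finset.sum_congr rfl fun y hy => by rw [(Finset.mem_filter.1 hy).2], Finset.sum_const]

theorem partition_twentySeven {a b c d e f h i : ℕ}
    (hs : 5 * a + 7 * b + 11 * c + 13 * d + 17 * e + 19 * f + 23 * h + 29 * i = 27) :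
    f = 0 ∧ h = 0 ∧ i = 0 ∧ ((a = 4 ∧ b = 1 ∧ c = 0 ∧ d = 0 ∧ e = 0) ∨
      (a = 1 ∧ b = 0 ∧ c = 2 ∧ d = 0 ∧ e = 0) ∨ (a = 2 ∧ b = 0 ∧ c = 0 ∧ d = 0 ∧ e = 1) ∨
      (a = 0 ∧ b = 2 ∧ c = 0 ∧ d = 1 ∧ e = 0)) := by
  have hi : i = 0 := by omega
  have hh : h ≤ 1 := by omega
  have hf : f ≤ 1 := by omega
  have he : e ≤ 1 := by omega
  have hd : d ≤ 2 := by omega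
  have hc : c ≤ 2 := by omega
  have hb : b ≤ 3 := by omega
  interval_cases h <;> interval_cases f <;> interval_cases e <;> interval_cases d <;>
    interval_cases c <;> interval_cases b <;> omega

theorem mainTheorem4
    (m : ℕ) (hm : 0 < m) (hprime : ∀ p : ℕ, p.Prime → p ∣ m → 5 ≤ p)
    (ζ : ℂ) (hζ : IsPrimitiveRoot ζ m)
    {C : Type*} [CommGroup C] [Fintype C] (hC : Fintype.card C = m)
    (g : C) (hg : ∀ c : C, c ∈ Subgroup.zpowers g)
    (f : (Fin 3 → ZMod 3) → ZMod m) (hf : GBF.IsGBF ζ f)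
    (x : Fin 3 → ZMod 3) (hx : x ≠ 0) :
    (5 ∣ m ∧ 7 ∣ m ∧ ∃ α β γ δ ω : ℤ,
      GBF.autocorr g f x =
        GBF.D C 5 * (GBF.elt (g ^ α) + GBF.elt (g ^ β) + GBF.elt (g ^ γ) + GBF.elt (g ^ δ))
          + GBF.D C 7 * GBF.elt (g ^ ω)) ∨
    (5 ∣ m ∧ 11 ∣ m ∧ ∃ α β γ : ℤ,
      GBF.autocorr g f x =
        GBF.D C 5 * GBF.elt (g ^ α)
          + GBF.D C 11 * (GBF.elt (g ^ β) + GBF.elt (g ^ γ))) ∨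
    (5 ∣ m ∧ 17 ∣ m ∧ ∃ α β γ : ℤ,
      GBF.autocorr g f x =
        GBF.D C 5 * (GBF.elt (g ^ α) + GBF.elt (g ^ β))
          + GBF.D C 17 * GBF.elt (g ^ γ)) ∨
    (7 ∣ m ∧ 13 ∣ m ∧ ∃ α β γ : ℤ,
      GBF.autocorr g f x =
        GBF.D C 7 * (GBF.elt (g ^ α) + GBF.elt (g ^ β))
          + GBF.D C 13 * GBF.elt (g ^ γ)) := by
  classical
  have : NeZero m := ⟨hm.ne'⟩
  have hzero := hf.sum_eq_zero hζ.pow_eq_one hx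
  obtain ⟨χ, hχ, hχg⟩ := exists_injective_hom hg (hC.symm ▸ hζ)
  let e : (Fin 3 → ZMod 3) → C := fun y => g ^ (f (x + y) - f y).val
  let u : C → ℕ := fun c => (Finset.univ.filter fun y => e y = c).card
  have hu : ∑ c, u c = 27 := by
    have h := sum_card_fiber_smul e fun _ => 1
    simp only [smul_eq_mul, mul_one] at h
    simp [u, h]
  have hval : ∑ c, (u c : ℂ) * χ c = 0 := by
    rw [← hzero, ← hχg]
    simpa [e] using sum_card_fiber_smul e χ
  have hauto : GBF.autocorr g f x = ∑ c, u c • GBF.elt c := (sum_card_fiber_smul e GBF.elt).symm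
  rw [← hC] at hprime
  obtain ⟨A, hA, hcard, hsum⟩ := exists_coset_decomposition hprime hχ 27 (by norm_num) u hu hval
  rw [hC] at hA hprime
  have hdvd : ∀ r, (A r).card ≠ 0 → r ∣ m := fun r h => (hA r fun h0 => h (by simp [h0])).2
  have hnil : ∀ r, (r.Prime → r < 5) → (A r).card = 0 := by
    intro r h
    by_contra h0
    obtain ⟨h1, h2⟩ := hA r fun h' => h0 (by simp [h'])
    exact absurd (h h1) (not_lt.2 (hprime r h1 h2))
  choose l hlen hl using fun r => Multiset.exists_map_elt_sum hg (A r)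
  rw [← hauto] at hsum
  simp only [← hlen] at hcard hdvd hnil
  simp only [hl] at hsum
  rw [hsum]
  have hl0 : ∀ r, (l r).length = 0 → l r = [] := fun r => List.length_eq_zero_iff.1
  -- Below 30, the indices that are not primes at least 5.
  have hcomp : ∀ r ∈ ([0, 1, 2, 3, 4, 6, 8, 9, 10, 12, 14, 15, 16, 18, 20, 21, 22, 24, 25, 26, 27,
      28] : List ℕ), l r = [] := by
    intro r hr
    refine hl0 r (hnil r ?_)
    revert r
    decide
  simp only [List.mem_cons, List.not_mem_nil, or_false, forall_eq_or_imp, forall_eq] at hcomp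
  simp only [Finset.sum_range_succ, Finset.sum_range_zero, hcomp, List.length_nil, List.map_nil,
    List.sum_nil, mul_zero, add_zero, zero_add] at hcard ⊢
  obtain ⟨h19, h23, h29, hcases⟩ := partition_twentySeven hcard
  rw [hl0 19 h19, hl0 23 h23, hl0 29 h29]
  rcases hcases with ⟨h5, h7, h11, h13, h17⟩ | ⟨h5, h7, h11, h13, h17⟩ | ⟨h5, h7, h11, h13, h17⟩ |
    ⟨h5, h7, h11, h13, h17⟩
  · refine Or.inl ⟨hdvd 5 (by omega), hdvd 7 (by omega), ?_⟩
    obtain ⟨a, t, ht⟩ := List.exists_of_length_succ _ h5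
    obtain ⟨b, c, d, rfl⟩ := List.length_eq_three.1 (by simpa [ht] using h5 : t.length = 3)
    obtain ⟨w, hw⟩ := List.length_eq_one_iff.1 h7
    exact ⟨a, b, c, d, w, by simp [ht, hw, hl0 _ h11, hl0 _ h13, hl0 _ h17, add_assoc]⟩
  · refine Or.inr (Or.inl ⟨hdvd 5 (by omega), hdvd 11 (by omega), ?_⟩)
    obtain ⟨a, ha⟩ := List.length_eq_one_iff.1 h5
    obtain ⟨b, c, hb⟩ := List.length_eq_two.1 h11
    exact ⟨a, b, c, by simp [ha, hb, hl0 _ h7, hl0 _ h13, hl0 _ h17]⟩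
  · refine Or.inr (Or.inr (Or.inl ⟨hdvd 5 (by omega), hdvd 17 (by omega), ?_⟩))
    obtain ⟨a, b, ha⟩ := List.length_eq_two.1 h5
    obtain ⟨c, hc⟩ := List.length_eq_one_iff.1 h17
    exact ⟨a, b, c, by simp [ha, hc, hl0 _ h7, hl0 _ h11, hl0 _ h13]⟩
  · refine Or.inr (Or.inr (Or.inr ⟨hdvd 7 (by omega), hdvd 13 (by omega), ?_⟩))
    obtain ⟨a, b, ha⟩ := List.length_eq_two.1 h7
    obtain ⟨c, hc⟩ := List.length_eq_one_iff.1 h13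
    exact ⟨a, b, c, by simp [ha, hc, hl0 _ h5, hl0 _ h11, hl0 _ h17]⟩
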